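/- Let $n\ge 1$ and let $\mathfrak S_n$ be the symmetric group on $\{1,\dots,n\}$. For $\sigma=\sigma_1\cdots\sigma_n\in\mathfrak S_n$ let $\mathsf{rmax}(\sigma)$, $\mathsf{rmin}(\sigma)$, $\mathsf{lmax}(\sigma)$, $\mathsf{lmin}(\sigma)$ be the numbers of right-to-left maxima, right-to-left minima, left-to-right maxima and left-to-right minima of the word $\sigma_1\cdots\sigma_n$, and let $\mathsf{cyc}(\sigma)$ be the number of cycles of $\sigma$ (fixed points included). Let the $B$-code of $\sigma$ be $(b_1,\dots,b_n)$ with $b_i=\sigma^{-k_i}(i)$, where $k_i\ge1$ is the smallest integer such that $\sigma^{-k_i}(i)\le i$, and let $\mathsf{lmic}_1(\sigma)=\#\{i: b_i=1\}$. Let the sorting index be $\mathsf{sor}(\sigma)=\sum_{r=1}^k (j_r-i_r)$, where $\sigma=(i_1j_1)\cdots(i_kj_k)$ is the unique factorization into transpositions with $i_r<j_r$ for all $r$ and $j_1<\cdots<j_k$ (products are composed from right to left). Put $$F_n(q,x,y)=\sum_{\sigma\in\mathfrak S_n}q^{\mathsf{sor}(\sigma)}x^{\mathsf{cyc}(\sigma)}y^{\mathsf{lmic}_1(\sigma)}.$$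 A pair $(a,b)$ of statistics is called symmetric if $(a,b)$ and $(b,a)$ have the same joint distribution over $\mathfrak S_n$; pairs $(a,b)$ and $(c,d)$ are called jointly equidistributed if $\#\{\sigma: a(\sigma)=k,\ b(\sigma)=m\}=\#\{\sigma: c(\sigma)=k,\ d(\sigma)=m\}$ for all $k,m$. Then: 1. The pairs $(\mathsf{rmax},\mathsf{rmin})$, $(\mathsf{rmax},\mathsf{lmax})$, $(\mathsf{rmin},\mathsf{lmin})$, $(\mathsf{lmax},\mathsf{lmin})$, $(\mathsf{cyc},\mathsf{lmic}_1)$ and $(\mathsf{lmic}_1,\mathsf{lmax})$ are each symmetric and are jointly equidistributed with one another. For each of these pairs $(a,b)$ the generating function is $$\sum_{\sigma\in\mathfrak S_n}x^{a(\sigma)}y^{b(\sigma)}=F_n(1,x,y)=xy\prod_{r=2}^n(x+y+r-2).$$ 2. The pairs $(\mathsf{rmax},\mathsf{lmin})$, $(\mathsf{rmin},\mathsf{lmax})$, $(\mathsf{cyc},\mathsf{lmax})$ and $(\mathsf{cyc},\mathsf{rmin})$ are each symmetric and are jointly equidistributed with one another. -/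

import Mathlib

open Finset BigOperators

namespace PermStat

variable {n : ℕ}

/-! A permutation of `{1, …, n}` is an element of `Equiv.Perm (Fin n)`; the number `i` of the paper
is the element of `Fin n` of value `i - 1`. A statistic is a map `Equiv.Perm (Fin n) → ℕ`. -/

/-- The number of right-to-left maxima. -/
def rmax (σ : Equiv.Perm (Fin n)) : ℕ := #{i : Fin n | ∀ j, i < j → σ j < σ i}

/-- The number of right-to-left minima. -/
def rmin (σ : Equiv.Perm (Fin n)) : ℕ := #{i : Fin n | ∀ j, i < j → σ i < σ j}

/-- The number of left-to-right maxima. -/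
def lmax (σ : Equiv.Perm (Fin n)) : ℕ := #{i : Fin n | ∀ j, j < i → σ j < σ i}

/-- The number of left-to-right minima. -/
def lmin (σ : Equiv.Perm (Fin n)) : ℕ := #{i : Fin n | ∀ j, j < i → σ i < σ j}

/-- The number of cycles of `σ`, fixed points included. -/
noncomputable def cyc (σ : Equiv.Perm (Fin n)) : ℕ :=
  Nat.card (Quotient (Equiv.Perm.SameCycle.setoid σ))

theorem exists_bCode_index (σ : Equiv.Perm (Fin n)) (i : Fin n) :
    ∃ k : ℕ, 1 ≤ k ∧ (σ⁻¹ ^ k) i ≤ i :=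
  ⟨orderOf σ⁻¹, orderOf_pos _, by simp [pow_orderOf_eq_one]⟩

/-- The `B`-code: `b_i = σ^{-k}(i)` where `k ≥ 1` is the smallest integer with `σ^{-k}(i) ≤ i`. -/
def bCode (σ : Equiv.Perm (Fin n)) (i : Fin n) : Fin n :=
  (σ⁻¹ ^ Nat.find (exists_bCode_index σ i)) i

/-- The number of indices `i` whose `B`-code entry is the number `1`
(that is, the element of `Fin n` of value `0`). -/
def lmic₁ (σ : Equiv.Perm (Fin n)) : ℕ := #{i : Fin n | (bCode σ i : ℕ) = 0}

/-- `l = [(i₁, j₁), …, (i_k, j_k)]` encodes a factorization `σ = (i₁ j₁) ⋯ (i_k j_k)` into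
transpositions with `i_r < j_r` for all `r` and `j₁ < ⋯ < j_k`. -/
def IsSortingFactorization (σ : Equiv.Perm (Fin n)) (l : List (Fin n × Fin n)) : Prop :=
  (∀ p ∈ l, p.1 < p.2) ∧ l.Pairwise (fun p p' => p.2 < p'.2) ∧
    (l.map fun p => Equiv.swap p.1 p.2).prod = σ

theorem prod_fix (l : List (Fin n × Fin n)) (a : Fin n)
    (h : ∀ p ∈ l, p.1 < a ∧ p.2 < a) : (l.map fun p => Equiv.swap p.1 p.2).prod a = a := by
  induction l with
  | nil => simp
  | cons p l ih =>
    rw [List.map_cons, List.prod_cons, Equiv.Perm.mul_apply, ih fun q hq => h q (by simp [hq])]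
    have := h p (by simp)
    exact Equiv.swap_apply_of_ne_of_ne this.1.ne' this.2.ne'

theorem exists_sortingFactorization (σ : Equiv.Perm (Fin n)) :
    ∃ l, IsSortingFactorization σ l := by
  suffices H : ∀ m : ℕ, ∀ σ : Equiv.Perm (Fin n), (∀ i : Fin n, m ≤ i → σ i = i) →
      ∃ l, IsSortingFactorization σ l ∧ ∀ p ∈ l, (p.2 : ℕ) < m by
    obtain ⟨l, hl, -⟩ := H n σ fun i hi => absurd i.2 (by omega)
    exact ⟨l, hl⟩
  intro m
  induction m with
  | zero =>
    intro σ h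
    exact ⟨[], ⟨by simp, by simp, by ext i; simp [h i]⟩, by simp⟩
  | succ m ih =>
    intro σ h
    by_cases hm : m < n
    · set j : Fin n := ⟨m, hm⟩ with hj
      set i := σ⁻¹ j with hi
      have hij : σ i = j := by simp [hi]
      have him : (i : ℕ) ≤ m := by
        by_contra hc
        have h1 := h i (by omega)
        rw [hij] at h1
        rw [← h1] at hc
        exact hc le_rfl
      by_cases he : i = j
      · obtain ⟨l, hl, hl'⟩ := ih σ fun k hk => by
          rcases Nat.eq_or_lt_of_le hk with hk | hk
          · have : k = j := Fin.ext hk.symm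
            rw [this, ← he, hij, he]
          · exact h k hk
        exact ⟨l, hl, fun p hp => (hl' p hp).trans (Nat.lt_succ_self m)⟩
      · have hlt : i < j := lt_of_le_of_ne him he
        obtain ⟨l, ⟨h1, h2, h3⟩, hl'⟩ := ih (σ * Equiv.swap i j) fun k hk => by
          rcases Nat.eq_or_lt_of_le hk with hk | hk
          · have : k = j := Fin.ext hk.symm
            rw [this, Equiv.Perm.mul_apply, Equiv.swap_apply_right, hij]
          · rw [Equiv.Perm.mul_apply, Equiv.swap_apply_of_ne_of_ne]
            · exact h k hk
            · rintro rfl; omega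
            · rintro rfl; simp [hj] at hk
        refine ⟨l ++ [(i, j)], ⟨?_, ?_, ?_⟩, ?_⟩
        · intro p hp
          rcases List.mem_append.1 hp with hp | hp
          · exact h1 p hp
          · rw [List.mem_singleton.1 hp]; exact hlt
        · rw [List.pairwise_append]
          refine ⟨h2, by simp, fun p hp q hq => ?_⟩
          rw [List.mem_singleton.1 hq]
          exact hl' p hp
        · simp [h3, mul_assoc]
        · intro p hp
          rcases List.mem_append.1 hp with hp | hp
          · exact (hl' p hp).trans (Nat.lt_succ_self m)
          · rw [List.mem_singleton.1 hp]; exact Nat.lt_succ_self m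
    · obtain ⟨l, hl, hl'⟩ := ih σ fun k hk => absurd k.2 (by omega)
      exact ⟨l, hl, fun p hp => (hl' p hp).trans (Nat.lt_succ_self m)⟩

theorem sortingFactorization_unique (l l' : List (Fin n × Fin n)) (σ : Equiv.Perm (Fin n))
    (h : IsSortingFactorization σ l) (h' : IsSortingFactorization σ l') : l = l' := by
  -- the last transposition `(i j)` is determined by `σ`: `j` is the largest point moved by `σ`,
  -- and `i = σ⁻¹ j`
  have key : ∀ (l : List (Fin n × Fin n)) (p : Fin n × Fin n) (σ : Equiv.Perm (Fin n)),
      IsSortingFactorization σ (l ++ [p]) →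
      IsSortingFactorization (σ * Equiv.swap p.1 p.2) l ∧ p.1 < p.2 ∧ σ p.1 = p.2 ∧
        ∀ k, p.2 < k → σ k = k := by
    rintro l p σ ⟨h1, h2, h3⟩
    rw [List.pairwise_append] at h2
    have hp : p.1 < p.2 := h1 p (by simp)
    have hlt : ∀ q ∈ l, q.2 < p.2 := fun q hq => h2.2.2 q hq p (by simp)
    have hσ : σ = (l.map fun p => Equiv.swap p.1 p.2).prod * Equiv.swap p.1 p.2 := by
      rw [← h3]; simp
    refine ⟨⟨fun q hq => h1 q (by simp [hq]), h2.1, ?_⟩, hp, ?_, ?_⟩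
    · rw [hσ, mul_assoc, Equiv.swap_mul_self, mul_one]
    · rw [hσ, Equiv.Perm.mul_apply, Equiv.swap_apply_left]
      exact prod_fix l _ fun q hq => ⟨(h1 q (by simp [hq])).trans (hlt q hq), hlt q hq⟩
    · intro k hk
      rw [hσ, Equiv.Perm.mul_apply, Equiv.swap_apply_of_ne_of_ne (hp.trans hk).ne' hk.ne']
      exact prod_fix l _ fun q hq =>
        ⟨((h1 q (by simp [hq])).trans (hlt q hq)).trans hk, (hlt q hq).trans hk⟩
  induction l using List.reverseRecOn generalizing l' σ with
  | nil =>
    rcases List.eq_nil_or_concat l' with rfl | ⟨m, p, rfl⟩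
    · rfl
    · rw [List.concat_eq_append] at h'
      obtain ⟨-, hp, hσ, -⟩ := key _ _ _ h'
      have : σ = 1 := by rw [← h.2.2]; simp
      rw [this] at hσ
      exact absurd hσ hp.ne
  | append_singleton l p ih =>
    rcases List.eq_nil_or_concat l' with rfl | ⟨m, q, rfl⟩
    · obtain ⟨-, hp, hσ, -⟩ := key _ _ _ h
      have : σ = 1 := by rw [← h'.2.2]; simp
      rw [this] at hσ
      exact absurd hσ hp.ne
    · rw [List.concat_eq_append] at h' ⊢
      obtain ⟨a1, a2, a3, a4⟩ := key _ _ _ h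
      obtain ⟨b1, b2, b3, b4⟩ := key _ _ _ h'
      have e2 : p.2 = q.2 := by
        rcases lt_trichotomy p.2 q.2 with hc | hc | hc
        · have h5 := σ.injective (b3.trans (a4 _ hc).symm)
          exact absurd h5 b2.ne
        · exact hc
        · have h5 := σ.injective (a3.trans (b4 _ hc).symm)
          exact absurd h5 a2.ne
      have e1 : p.1 = q.1 := σ.injective (a3.trans (e2.trans b3.symm))
      have e : p = q := Prod.ext e1 e2
      subst e
      rw [ih _ _ a1 b1]

theorem existsUnique_sortingFactorization (σ : Equiv.Perm (Fin n)) :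
    ∃! l, IsSortingFactorization σ l := by
  obtain ⟨l, hl⟩ := exists_sortingFactorization σ
  exact ⟨l, hl, fun l' hl' => sortingFactorization_unique l' l σ hl' hl⟩

/-- The sorting index: `∑ (j_r - i_r)` over the unique factorization `σ = (i₁ j₁) ⋯ (i_k j_k)`
with `i_r < j_r` and `j₁ < ⋯ < j_k`. -/
noncomputable def sor (σ : Equiv.Perm (Fin n)) : ℕ :=
  ((existsUnique_sortingFactorization σ).choose.map fun p => (p.2 : ℕ) - (p.1 : ℕ)).sum

/-- `F_n(q, x, y) = ∑_σ q^{sor σ} x^{cyc σ} y^{lmic₁ σ}`, evaluated in a commutative ring. -/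
noncomputable def F (n : ℕ) {R : Type*} [CommRing R] (q x y : R) : R :=
  ∑ σ : Equiv.Perm (Fin n), q ^ sor σ * x ^ cyc σ * y ^ lmic₁ σ

/-- The generating function `∑_σ x^{a σ} y^{b σ}` of a pair `(a, b)` of statistics. -/
def genFun (a b : Equiv.Perm (Fin n) → ℕ) {R : Type*} [CommRing R] (x y : R) : R :=
  ∑ σ : Equiv.Perm (Fin n), x ^ a σ * y ^ b σ

/-- Two pairs of statistics have the same joint distribution over the symmetric group. -/
def JointlyEquidistributed (s t : (Equiv.Perm (Fin n) → ℕ) × (Equiv.Perm (Fin n) → ℕ)) : Prop :=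
  ∀ k m : ℕ, #{σ : Equiv.Perm (Fin n) | s.1 σ = k ∧ s.2 σ = m} =
    #{σ : Equiv.Perm (Fin n) | t.1 σ = k ∧ t.2 σ = m}

/-- A pair `(a, b)` of statistics is symmetric if `(a, b)` and `(b, a)` have the same joint
distribution. -/
def SymmetricPair (s : (Equiv.Perm (Fin n) → ℕ) × (Equiv.Perm (Fin n) → ℕ)) : Prop :=
  JointlyEquidistributed s s.swap

/-- The pairs of the first family. -/
noncomputable def pairs₁ (n : ℕ) :
    List ((Equiv.Perm (Fin n) → ℕ) × (Equiv.Perm (Fin n) → ℕ)) :=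
  [(rmax, rmin), (rmax, lmax), (rmin, lmin), (lmax, lmin), (cyc, lmic₁), (lmic₁, lmax)]

/-- The pairs of the second family. -/
noncomputable def pairs₂ (n : ℕ) :
    List ((Equiv.Perm (Fin n) → ℕ) × (Equiv.Perm (Fin n) → ℕ)) :=
  [(rmax, lmin), (rmin, lmax), (cyc, lmax), (cyc, rmin)]

end PermStat

namespace PermStat

open Equiv

/-! Explicit bijections of the symmetric group carry every pair of the first family to `(lmax,
lmin)` and every pair of the second to `(lmax, rmin)`. For pairs of word statistics, reversal,
complement and inversion suffice.

For `cyc` and `lmic₁`, permutations are grown one point at a time in two ways, each with a free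
choice of `c`: `appendLetter` writes `c` at the end of the word, and `insertInCycle` multiplies by
the transposition of `c` and the new largest point. In the first, `lmax` grows exactly when `c` is
largest and `lmin` exactly when `c` is `0`. In the second, the same choices make `cyc` and `lmic₁`
grow, since the `B`-code just gains the entry `c`. Matching the choices recursively gives a
bijection `e` with `cyc ∘ e = lmax` and `lmic₁ ∘ e = lmin`. It also satisfies `lmax ∘ e = rmin`,
because `e σ` and `σ⁻¹` have their left-to-right maxima at the same positions
(`exists_equiv_cyc_lmic₁_isLmax`).

The effect of `c` does not depend on the permutation being extended, so the generating function of
`(lmax, lmin)` is a product. -/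

/-! ### Equidistribution through a bijection -/

/-- Two pairs of statistics correspond under a bijection of the symmetric group. -/
def Corresponds (s t : (Perm (Fin n) → ℕ) × (Perm (Fin n) → ℕ)) : Prop :=
  ∃ e : Perm (Fin n) ≃ Perm (Fin n), ∀ σ, s.1 (e σ) = t.1 σ ∧ s.2 (e σ) = t.2 σ

theorem Corresponds.refl (s : (Perm (Fin n) → ℕ) × (Perm (Fin n) → ℕ)) : Corresponds s s :=
  ⟨Equiv.refl _, fun _ => ⟨rfl, rfl⟩⟩

theorem Corresponds.symm {s t : (Perm (Fin n) → ℕ) × (Perm (Fin n) → ℕ)}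
    (h : Corresponds s t) : Corresponds t s := by
  obtain ⟨e, he⟩ := h
  refine ⟨e.symm, fun σ => ?_⟩
  have := he (e.symm σ)
  simp only [Equiv.apply_symm_apply] at this
  exact ⟨this.1.symm, this.2.symm⟩

theorem Corresponds.trans {s t u : (Perm (Fin n) → ℕ) × (Perm (Fin n) → ℕ)}
    (h : Corresponds s t) (h' : Corresponds t u) : Corresponds s u := by
  obtain ⟨e, he⟩ := h
  obtain ⟨f, hf⟩ := h'
  exact ⟨f.trans e, fun σ => ⟨(he _).1.trans (hf σ).1, (he _).2.trans (hf σ).2⟩⟩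

theorem Corresponds.swap {s t : (Perm (Fin n) → ℕ) × (Perm (Fin n) → ℕ)}
    (h : Corresponds s t) : Corresponds s.swap t.swap := by
  obtain ⟨e, he⟩ := h
  exact ⟨e, fun σ => ⟨(he σ).2, (he σ).1⟩⟩

theorem Corresponds.jointlyEquidistributed {s t : (Perm (Fin n) → ℕ) × (Perm (Fin n) → ℕ)}
    (h : Corresponds s t) : JointlyEquidistributed s t := by
  obtain ⟨e, he⟩ := h
  intro k m
  refine (Finset.card_equiv e fun σ => ?_).symm
  simp [(he σ).1, (he σ).2]

theorem Corresponds.genFun_eq {s t : (Perm (Fin n) → ℕ) × (Perm (Fin n) → ℕ)}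
    (h : Corresponds s t) {R : Type*} [CommRing R] (x y : R) :
    genFun s.1 s.2 x y = genFun t.1 t.2 x y := by
  obtain ⟨e, he⟩ := h
  unfold genFun
  rw [← e.sum_comp]
  simp only [(he _).1, (he _).2]

/-! ### Reversal, complement and inverse -/

theorem lmax_mul_rev (σ : Perm (Fin n)) : lmax (σ * Fin.revPerm) = rmax σ := by
  refine Finset.card_equiv Fin.revPerm fun i => ?_
  simp only [Finset.mem_filter_univ, Perm.mul_apply, Fin.revPerm_apply]
  rw [← Fin.revPerm.forall_congr_right]
  simp [Fin.rev_lt_iff]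

theorem lmin_mul_rev (σ : Perm (Fin n)) : lmin (σ * Fin.revPerm) = rmin σ := by
  refine Finset.card_equiv Fin.revPerm fun i => ?_
  simp only [Finset.mem_filter_univ, Perm.mul_apply, Fin.revPerm_apply]
  rw [← Fin.revPerm.forall_congr_right]
  simp [Fin.rev_lt_iff]

theorem rmax_mul_rev (σ : Perm (Fin n)) : rmax (σ * Fin.revPerm) = lmax σ := by
  rw [← lmax_mul_rev, mul_assoc]
  congr 1
  ext i
  simp

theorem rmin_mul_rev (σ : Perm (Fin n)) : rmin (σ * Fin.revPerm) = lmin σ := by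
  rw [← lmin_mul_rev, mul_assoc]
  congr 1
  ext i
  simp

theorem lmax_rev_mul (σ : Perm (Fin n)) : lmax (Fin.revPerm * σ) = lmin σ := by
  simp [lmax, lmin]

theorem lmin_rev_mul (σ : Perm (Fin n)) : lmin (Fin.revPerm * σ) = lmax σ := by
  simp [lmax, lmin]

theorem rmin_rev_mul (σ : Perm (Fin n)) : rmin (Fin.revPerm * σ) = rmax σ := by
  simp [rmax, rmin]

/-- Inversion reflects the diagram of points `(i, σ i)` in the diagonal, so "no point to the left
and above" becomes "no point to the right and below". The empty lower left quadrant in `lmin_inv` is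
its own reflection. -/
theorem lmax_inv (σ : Perm (Fin n)) : lmax σ⁻¹ = rmin σ := by
  refine Finset.card_equiv σ⁻¹ fun i => ?_
  simp only [Finset.mem_filter_univ]
  constructor
  · intro h j hj
    by_contra hc
    rw [Perm.coe_inv, Equiv.apply_symm_apply, not_lt] at hc
    rcases hc.eq_or_lt with hc | hc
    · simp [← hc] at hj
    · have := h _ hc
      rw [Perm.coe_inv, Equiv.symm_apply_apply] at this
      exact lt_asymm this hj
  · intro h j hj
    by_contra hc
    rcases (not_lt.1 hc).eq_or_lt with hc | hc
    · exact hj.ne (σ⁻¹.injective hc.symm)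
    · have := h _ hc
      simp only [Perm.coe_inv, Equiv.apply_symm_apply] at this
      exact lt_asymm this hj

theorem lmin_inv (σ : Perm (Fin n)) : lmin σ⁻¹ = lmin σ := by
  refine Finset.card_equiv σ⁻¹ fun i => ?_
  simp only [Finset.mem_filter_univ]
  constructor
  · intro h j hj
    by_contra hc
    rw [Perm.coe_inv, Equiv.apply_symm_apply, not_lt] at hc
    rcases hc.eq_or_lt with hc | hc
    · simp [← hc] at hj
    · have := h _ hc
      rw [Perm.coe_inv, Equiv.symm_apply_apply] at this
      exact lt_asymm this hj
  · intro h j hj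
    by_contra hc
    rcases (not_lt.1 hc).eq_or_lt with hc | hc
    · exact hj.ne (σ⁻¹.injective hc)
    · have := h _ hc
      simp only [Perm.coe_inv, Equiv.apply_symm_apply] at this
      exact lt_asymm this hj

/-! ### Inserting a last letter -/

/-- The permutation whose word is that of `σ` with the letter `c` appended, the letters of `σ`
that are at least `c` being increased by one. -/
def appendLetter (σ : Perm (Fin n)) (c : Fin (n + 1)) : Perm (Fin (n + 1)) :=
  ((finSuccEquiv' (Fin.last n)).trans (Equiv.optionCongr σ)).trans (finSuccEquiv' c).symm

@[simp] theorem appendLetter_last (σ : Perm (Fin n)) (c : Fin (n + 1)) :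
    appendLetter σ c (Fin.last n) = c := by
  simp [appendLetter]

@[simp] theorem appendLetter_castSucc (σ : Perm (Fin n)) (c : Fin (n + 1)) (i : Fin n) :
    appendLetter σ c i.castSucc = c.succAbove (σ i) := by
  rw [← Fin.succAbove_last_apply]
  simp only [appendLetter, Equiv.trans_apply, finSuccEquiv'_succAbove]
  simp

@[simp] theorem appendLetter_inv_self (σ : Perm (Fin n)) (c : Fin (n + 1)) :
    (appendLetter σ c)⁻¹ c = Fin.last n := by
  rw [Perm.inv_eq_iff_eq, appendLetter_last]

@[simp] theorem appendLetter_inv_succAbove (σ : Perm (Fin n)) (c : Fin (n + 1)) (i : Fin n) :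
    (appendLetter σ c)⁻¹ (c.succAbove i) = (σ⁻¹ i).castSucc := by
  rw [Perm.inv_eq_iff_eq, appendLetter_castSucc, Perm.coe_inv, Equiv.apply_symm_apply]

theorem appendLetter_injective :
    Function.Injective fun p : Perm (Fin n) × Fin (n + 1) => appendLetter p.1 p.2 := by
  rintro ⟨σ, c⟩ ⟨τ, d⟩ h
  have hcd : c = d := by simpa using DFunLike.congr_fun h (Fin.last n)
  subst hcd
  refine Prod.ext (Equiv.ext fun i => ?_) rfl
  simpa using DFunLike.congr_fun h i.castSucc

/-- The permutation obtained from `σ` by letting it fix the new point `n` and multiplying it on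
the right by the transposition of `c` and `n`. -/
def insertInCycle (σ : Perm (Fin n)) (c : Fin (n + 1)) : Perm (Fin (n + 1)) :=
  appendLetter σ (Fin.last n) * Equiv.swap c (Fin.last n)

@[simp] theorem insertInCycle_self (σ : Perm (Fin n)) (c : Fin (n + 1)) :
    insertInCycle σ c c = Fin.last n := by
  simp [insertInCycle]

theorem insertInCycle_castSucc_of_ne (σ : Perm (Fin n)) (c : Fin (n + 1)) (i : Fin n)
    (h : i.castSucc ≠ c) : insertInCycle σ c i.castSucc = (σ i).castSucc := by
  rw [insertInCycle, Perm.mul_apply, Equiv.swap_apply_of_ne_of_ne h (Fin.castSucc_lt_last i).ne,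
    appendLetter_castSucc, Fin.succAbove_last]

theorem insertInCycle_castSucc_last (σ : Perm (Fin n)) (i : Fin n) :
    insertInCycle σ i.castSucc (Fin.last n) = (σ i).castSucc := by
  simp [insertInCycle]

theorem insertInCycle_injective :
    Function.Injective fun p : Perm (Fin n) × Fin (n + 1) => insertInCycle p.1 p.2 := by
  rintro ⟨σ, c⟩ ⟨τ, d⟩ h
  -- `c` is recovered as the position of the largest letter.
  have hcd : c = d := by
    apply (insertInCycle τ d).injective
    rw [insertInCycle_self, ← insertInCycle_self σ c]
    exact (DFunLike.congr_fun h c).symm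
  subst hcd
  have := appendLetter_injective (a₁ := (σ, Fin.last n)) (a₂ := (τ, Fin.last n))
    (mul_right_cancel h)
  simpa using this

theorem bijective_of_injective_insertion {f : Perm (Fin n) × Fin (n + 1) → Perm (Fin (n + 1))}
    (hf : Function.Injective f) : Function.Bijective f := by
  rw [Fintype.bijective_iff_injective_and_card]
  refine ⟨hf, ?_⟩
  simp [Fintype.card_perm, Nat.factorial_succ, mul_comm]

/-- `appendLetter` as a bijection. -/
noncomputable def appendLetterEquiv (n : ℕ) :
    Perm (Fin n) × Fin (n + 1) ≃ Perm (Fin (n + 1)) :=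
  Equiv.ofBijective _ (bijective_of_injective_insertion appendLetter_injective)

/-- `insertInCycle` as a bijection. -/
noncomputable def insertInCycleEquiv (n : ℕ) :
    Perm (Fin n) × Fin (n + 1) ≃ Perm (Fin (n + 1)) :=
  Equiv.ofBijective _ (bijective_of_injective_insertion insertInCycle_injective)

/-! ### Left-to-right maxima and minima under insertion -/

/-- `c.succAbove` preserves the order of the old letters, and a letter at the end cannot affect
earlier positions. If `c` is not the largest letter, that letter stands before it. -/
theorem lmax_appendLetter (σ : Perm (Fin n)) (c : Fin (n + 1)) :
    lmax (appendLetter σ c) = lmax σ + if c = Fin.last n then 1 else 0 := by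
  have hlast : (∀ j : Fin n, c.succAbove (σ j) < c) ↔ c = Fin.last n := by
    constructor
    · intro h
      by_contra hc
      obtain ⟨v, hv⟩ := Fin.exists_succAbove_eq (Ne.symm hc)
      have := h (σ⁻¹ v)
      rw [Perm.coe_inv, Equiv.apply_symm_apply, hv] at this
      exact absurd this (Fin.le_last c).not_gt
    · rintro rfl j
      simp [Fin.castSucc_lt_last]
  simp only [lmax, Finset.card_filter, Fin.sum_univ_castSucc]
  congr 1
  · refine Finset.sum_congr rfl fun i _ => if_congr ?_ rfl rfl
    rw [Fin.forall_fin_succ']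
    simp [Fin.succAbove_lt_succAbove_iff, (Fin.castSucc_lt_last i).not_gt]
  · refine if_congr ?_ rfl rfl
    rw [Fin.forall_fin_succ', ← hlast]
    simp [Fin.castSucc_lt_last]

theorem lmin_appendLetter (σ : Perm (Fin n)) (c : Fin (n + 1)) :
    lmin (appendLetter σ c) = lmin σ + if c = 0 then 1 else 0 := by
  have hlast : (∀ j : Fin n, c < c.succAbove (σ j)) ↔ c = 0 := by
    constructor
    · intro h
      by_contra hc
      obtain ⟨v, hv⟩ := Fin.exists_succAbove_eq (Ne.symm hc)
      have := h (σ⁻¹ v)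
      rw [Perm.coe_inv, Equiv.apply_symm_apply, hv] at this
      exact absurd this (Fin.zero_le c).not_gt
    · rintro rfl j
      simp [Fin.succ_pos]
  simp only [lmin, Finset.card_filter, Fin.sum_univ_castSucc]
  congr 1
  · refine Finset.sum_congr rfl fun i _ => if_congr ?_ rfl rfl
    rw [Fin.forall_fin_succ']
    simp [Fin.succAbove_lt_succAbove_iff, (Fin.castSucc_lt_last i).not_gt]
  · refine if_congr ?_ rfl rfl
    rw [Fin.forall_fin_succ', ← hlast]
    simp [Fin.castSucc_lt_last]

/-- `σ` has a left-to-right maximum at position `i`. -/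
def IsLmax (σ : Perm (Fin n)) (i : Fin n) : Prop := ∀ j, j < i → σ j < σ i

/-- The left-to-right maxima of a permutation depend only on the position `c` of its largest letter
and on the letters before it. -/
theorem isLmax_iff_of_apply_eq_last {π : Perm (Fin (n + 1))} {ρ : Perm (Fin n)} {c : Fin (n + 1)}
    (hc : π c = Fin.last n)
    (hρ : ∀ i : Fin n, i.castSucc < c → π i.castSucc = (ρ i).castSucc) (k : Fin (n + 1)) :
    IsLmax π k ↔ k = c ∨ k < c ∧ ∃ i : Fin n, i.castSucc = k ∧ IsLmax ρ i := by
  rcases lt_trichotomy k c with h | rfl | h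
  · obtain ⟨i, rfl⟩ := Fin.exists_castSucc_eq.2 (h.trans_le (Fin.le_last c)).ne
    simp only [h.ne, h, false_or, true_and, Fin.castSucc_inj, exists_eq_left, IsLmax]
    rw [Fin.forall_fin_succ']
    simp only [(Fin.castSucc_lt_last i).not_gt, false_imp_iff, and_true, Fin.castSucc_lt_castSucc_iff]
    refine forall_congr' fun j => imp_congr_right fun hj => ?_
    rw [hρ i h, hρ j ((Fin.castSucc_lt_castSucc_iff.2 hj).trans h), Fin.castSucc_lt_castSucc_iff]
  · simp only [true_or, iff_true]
    intro j hj
    rw [hc]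
    exact lt_of_le_of_ne (Fin.le_last _) fun h => hj.ne (π.injective (h.trans hc.symm))
  · simp only [h.ne', h.not_gt, false_and, or_false, iff_false]
    intro hk
    have := hk c h
    rw [hc] at this
    exact absurd this (Fin.le_last _).not_gt

theorem lmax_eq_of_isLmax_iff {σ τ : Perm (Fin n)} (h : ∀ i, IsLmax σ i ↔ IsLmax τ i) :
    lmax σ = lmax τ := by
  unfold lmax
  congr 1
  ext i
  simpa [IsLmax] using h i

/-- Both permutations have their largest letter at position `c` and agree with `σ`, respectively
`τ⁻¹`, before it. Maxima after `c` are lost, so an induction must carry the set of positions and not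
only its size. -/
theorem isLmax_insertInCycle_iff_appendLetter_inv {σ τ : Perm (Fin n)}
    (h : ∀ i, IsLmax σ i ↔ IsLmax τ⁻¹ i) (c k : Fin (n + 1)) :
    IsLmax (insertInCycle σ c) k ↔ IsLmax (appendLetter τ c)⁻¹ k := by
  rw [isLmax_iff_of_apply_eq_last (insertInCycle_self σ c)
      fun i hi => insertInCycle_castSucc_of_ne σ c i hi.ne,
    isLmax_iff_of_apply_eq_last (appendLetter_inv_self τ c) (ρ := τ⁻¹)]
  · simp only [h]
  · intro i hi
    rw [← Fin.succAbove_of_castSucc_lt c i hi, appendLetter_inv_succAbove]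

/-! ### Cycles under insertion -/

/-- This turns maps of points into maps of cycle sets. `f` need be neither injective nor
equivariant: it is enough that each single step of `σ` stays within one cycle of `τ`. -/
theorem sameCycle_map {α β : Type*} {σ : Perm α} {τ : Perm β} (f : α → β)
    (hf : ∀ a, τ.SameCycle (f a) (f (σ a))) {a b : α} (h : σ.SameCycle a b) :
    τ.SameCycle (f a) (f b) := by
  obtain ⟨k, rfl⟩ := h
  induction k with
  | zero => exact Perm.SameCycle.refl _ _
  | succ k ih =>
    rw [add_comm, zpow_add, zpow_one, Perm.mul_apply]
    exact ih.trans (hf _)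
  | pred k ih =>
    refine ih.trans ?_
    have := hf ((σ ^ (-(k : ℤ) - 1)) a)
    rw [← Perm.mul_apply, ← zpow_one_add] at this
    rw [show (1 : ℤ) + (-(k : ℤ) - 1) = -k by ring] at this
    exact this.symm

theorem sameCycle_insertInCycle_castSucc (σ : Perm (Fin n)) (c : Fin (n + 1)) (i : Fin n) :
    (insertInCycle σ c).SameCycle i.castSucc (σ i).castSucc := by
  by_cases h : i.castSucc = c
  · subst h
    refine ⟨2, ?_⟩
    rw [zpow_two, Perm.mul_apply, insertInCycle_self, insertInCycle_castSucc_last]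
  · exact ⟨1, by rw [zpow_one, insertInCycle_castSucc_of_ne _ _ _ h]⟩

/-- The new point is spliced into the cycle of `c`, directly after `c`. The inclusion `Fin.castSucc`
and the retraction sending the new point to `c` induce mutually inverse maps on cycles. -/
theorem cyc_insertInCycle_castSucc (σ : Perm (Fin n)) (c : Fin n) :
    cyc (insertInCycle σ c.castSucc) = cyc σ := by
  have hr : ∀ x, σ.SameCycle ((Fin.lastCases c id x : Fin n))
      (Fin.lastCases c id (insertInCycle σ c.castSucc x) : Fin n) := by
    intro x
    induction x using Fin.lastCases with
    | last =>
      rw [insertInCycle_castSucc_last]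
      simpa using (Perm.SameCycle.refl σ c).apply_right
    | cast i =>
      by_cases h : i = c
      · subst h
        simp [Perm.SameCycle.refl]
      · rw [insertInCycle_castSucc_of_ne _ _ _ (by simpa using h)]
        simp [Perm.SameCycle.refl]
  refine Nat.card_congr ⟨Quotient.map _ fun a b h => sameCycle_map _ hr h,
    Quotient.map Fin.castSucc fun a b h =>
      sameCycle_map _ (sameCycle_insertInCycle_castSucc σ c.castSucc) h, ?_, ?_⟩
  · rintro ⟨x⟩
    refine Quotient.sound ?_
    induction x using Fin.lastCases with
    | last => exact ⟨1, by simp⟩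
    | cast i => simp
  · rintro ⟨x⟩
    refine Quotient.sound ?_
    simp

theorem insertInCycle_last_castSucc (σ : Perm (Fin n)) (i : Fin n) :
    insertInCycle σ (Fin.last n) i.castSucc = (σ i).castSucc :=
  insertInCycle_castSucc_of_ne _ _ _ (Fin.castSucc_lt_last i).ne

theorem cyc_insertInCycle_last (σ : Perm (Fin n)) :
    cyc (insertInCycle σ (Fin.last n)) = cyc σ + 1 := by
  let f : Fin (n + 1) → Option (Quotient (Perm.SameCycle.setoid σ)) :=
    Fin.lastCases none fun i => some (Quotient.mk _ i)
  -- For the identity permutation, lying in the same cycle means being equal, so `sameCycle_map`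
  -- shows that `f` is constant on cycles; `none` stands for the new fixed point.
  have hf : ∀ x, (1 : Perm (Option (Quotient (Perm.SameCycle.setoid σ)))).SameCycle (f x)
      (f (insertInCycle σ (Fin.last n) x)) := by
    intro x
    rw [Perm.sameCycle_one]
    induction x using Fin.lastCases with
    | last => simp
    | cast i =>
      simp only [f, insertInCycle_last_castSucc, Fin.lastCases_castSucc]
      exact congrArg some (Quotient.sound ⟨1, rfl⟩)
  rw [cyc, cyc, ← Finite.card_option]
  refine Nat.card_congr ⟨Quotient.lift f fun a b h => Perm.sameCycle_one.1 (sameCycle_map f hf h),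
    fun q => q.elim (Quotient.mk _ (Fin.last n)) (Quotient.map Fin.castSucc fun a b h =>
      sameCycle_map _ (sameCycle_insertInCycle_castSucc σ (Fin.last n)) h), ?_, ?_⟩
  · intro q
    induction q using Quotient.inductionOn with | _ x
    induction x using Fin.lastCases with
    | last => simp [f]
    | cast i => simp [f]
  · rintro (_ | q)
    · simp [f]
    · induction q using Quotient.inductionOn with | _ x
      simp [f]

theorem cyc_insertInCycle (σ : Perm (Fin n)) (c : Fin (n + 1)) :
    cyc (insertInCycle σ c) = cyc σ + if c = Fin.last n then 1 else 0 := by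
  induction c using Fin.lastCases with
  | last => simp [cyc_insertInCycle_last]
  | cast i => simp [cyc_insertInCycle_castSucc, (Fin.castSucc_lt_last i).ne]

theorem cyc_conj_rev (σ : Perm (Fin n)) : cyc (Fin.revPerm * σ * Fin.revPerm) = cyc σ := by
  refine Nat.card_congr (Quotient.congr Fin.revPerm fun a b => ?_)
  constructor
  · exact sameCycle_map Fin.revPerm fun a => ⟨1, by simp⟩
  · intro h
    have := sameCycle_map (τ := Fin.revPerm * σ * Fin.revPerm) Fin.revPerm
      (fun a => ⟨1, by simp⟩) h
    simp only [Fin.revPerm_apply, Fin.rev_rev] at this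
    exact this

/-! ### The `B`-code under insertion -/

/-- `y` is the first point that is at most `i` on the path `σ⁻¹ x, σ⁻² x, …`. -/
inductive FirstReturn (σ : Perm (Fin n)) (i : Fin n) : Fin n → Fin n → Prop
  | here (x : Fin n) : σ⁻¹ x ≤ i → FirstReturn σ i x (σ⁻¹ x)
  | step (x y : Fin n) : i < σ⁻¹ x → FirstReturn σ i (σ⁻¹ x) y → FirstReturn σ i x y

theorem FirstReturn.unique {σ : Perm (Fin n)} {i x y z : Fin n} (h : FirstReturn σ i x y)
    (h' : FirstReturn σ i x z) : y = z := by
  induction h with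
  | here x hx =>
    cases h' with
    | here => rfl
    | step _ _ h1 _ => exact absurd h1 hx.not_gt
  | step x y hx _ ih =>
    cases h' with
    | here => exact absurd hx (not_lt_of_ge ‹_›)
    | step _ _ _ h2 => exact ih h2

theorem firstReturn_pow (σ : Perm (Fin n)) (i : Fin n) (k : ℕ) (x : Fin n)
    (h : (σ⁻¹ ^ (k + 1)) x ≤ i) (hlt : ∀ m < k, i < (σ⁻¹ ^ (m + 1)) x) :
    FirstReturn σ i x ((σ⁻¹ ^ (k + 1)) x) := by
  induction k generalizing x with
  | zero => simpa using FirstReturn.here x (by simpa using h)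
  | succ k ih =>
    have h0 := hlt 0 (Nat.succ_pos k)
    rw [zero_add, pow_one] at h0
    rw [pow_succ, Perm.mul_apply] at h ⊢
    refine FirstReturn.step x _ h0 (ih _ h fun m hm => ?_)
    rw [← Perm.mul_apply, ← pow_succ]
    exact hlt (m + 1) (Nat.succ_lt_succ hm)

/-- With `FirstReturn.unique`, this characterizes the `B`-code without the exponent `k`, which can
change under insertion. -/
theorem firstReturn_bCode (σ : Perm (Fin n)) (i : Fin n) : FirstReturn σ i i (bCode σ i) := by
  have hs := Nat.find_spec (exists_bCode_index σ i)
  obtain ⟨k, hk⟩ := Nat.exists_eq_add_of_le' hs.1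
  rw [bCode]
  rw [hk] at hs ⊢
  refine firstReturn_pow σ i k i hs.2 fun m hm => ?_
  have := Nat.find_min (exists_bCode_index σ i) (m := m + 1) (by omega)
  simpa using this

theorem insertInCycle_inv_last (σ : Perm (Fin n)) (c : Fin (n + 1)) :
    (insertInCycle σ c)⁻¹ (Fin.last n) = c := by
  rw [Perm.inv_eq_iff_eq, insertInCycle_self]

theorem insertInCycle_inv_castSucc_of_ne (σ : Perm (Fin n)) (c : Fin (n + 1)) (x : Fin n)
    (h : (σ⁻¹ x).castSucc ≠ c) :
    (insertInCycle σ c)⁻¹ x.castSucc = (σ⁻¹ x).castSucc := by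
  rw [Perm.inv_eq_iff_eq, insertInCycle_castSucc_of_ne _ _ _ h, Perm.coe_inv, Equiv.apply_symm_apply]

theorem insertInCycle_inv_castSucc (σ : Perm (Fin n)) (x : Fin n) :
    (insertInCycle σ (σ⁻¹ x).castSucc)⁻¹ x.castSucc = Fin.last n := by
  rw [Perm.inv_eq_iff_eq, insertInCycle_castSucc_last, Perm.coe_inv, Equiv.apply_symm_apply]

theorem FirstReturn.insertInCycle {σ : Perm (Fin n)} {i x y : Fin n} (h : FirstReturn σ i x y)
    (c : Fin (n + 1)) : FirstReturn (insertInCycle σ c) i.castSucc x.castSucc y.castSucc := by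
  -- When `σ⁻¹ x` is `c`, the backward path from `x` now passes through the new point. That point
  -- exceeds `i`, so the detour is just one more `step`.
  have key : ∀ x z, (FirstReturn (PermStat.insertInCycle σ c) i.castSucc (Fin.last n) z →
      (σ⁻¹ x).castSucc = c → FirstReturn (PermStat.insertInCycle σ c) i.castSucc x.castSucc z) := by
    rintro x z h rfl
    have e := insertInCycle_inv_castSucc σ x
    refine FirstReturn.step _ _ ?_ ?_ <;> rw [e]
    · exact Fin.castSucc_lt_last i
    · exact h
  induction h with
  | here x hx =>
    by_cases hc : (σ⁻¹ x).castSucc = c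
    · refine key _ _ ?_ hc
      rw [hc]
      have := FirstReturn.here (σ := PermStat.insertInCycle σ c) (i := i.castSucc) (Fin.last n)
      rw [insertInCycle_inv_last] at this
      exact this (hc ▸ Fin.castSucc_le_castSucc_iff.2 hx)
    · have := FirstReturn.here (σ := PermStat.insertInCycle σ c) (i := i.castSucc) x.castSucc
      rw [insertInCycle_inv_castSucc_of_ne _ _ _ hc] at this
      exact this (Fin.castSucc_le_castSucc_iff.2 hx)
  | step x y hx _ ih =>
    by_cases hc : (σ⁻¹ x).castSucc = c
    · refine key _ _ (FirstReturn.step _ _ ?_ ?_) hc <;> rw [insertInCycle_inv_last, ← hc]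
      · exact Fin.castSucc_lt_castSucc_iff.2 hx
      · rwa [← hc] at ih
    · refine FirstReturn.step _ _ ?_ ?_ <;> rw [insertInCycle_inv_castSucc_of_ne _ _ _ hc]
      · exact Fin.castSucc_lt_castSucc_iff.2 hx
      · exact ih

theorem bCode_insertInCycle_castSucc (σ : Perm (Fin n)) (c : Fin (n + 1)) (i : Fin n) :
    bCode (insertInCycle σ c) i.castSucc = (bCode σ i).castSucc :=
  (firstReturn_bCode _ _).unique ((firstReturn_bCode σ i).insertInCycle c)

theorem bCode_insertInCycle_last (σ : Perm (Fin n)) (c : Fin (n + 1)) :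
    bCode (insertInCycle σ c) (Fin.last n) = c := by
  refine (firstReturn_bCode _ _).unique ?_
  have := FirstReturn.here (σ := insertInCycle σ c) (i := Fin.last n) (Fin.last n) (Fin.le_last _)
  rwa [insertInCycle_inv_last] at this

theorem lmic₁_insertInCycle (σ : Perm (Fin n)) (c : Fin (n + 1)) :
    lmic₁ (insertInCycle σ c) = lmic₁ σ + if c = 0 then 1 else 0 := by
  simp only [lmic₁, Finset.card_filter, Fin.sum_univ_castSucc, bCode_insertInCycle_castSucc,
    bCode_insertInCycle_last, Fin.val_castSucc, Fin.ext_iff, Fin.val_zero]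

/-! ### The bijection between words and cycles -/

theorem exists_equiv_cyc_lmic₁_isLmax (n : ℕ) : ∃ e : Perm (Fin n) ≃ Perm (Fin n), ∀ σ,
    cyc (e σ) = lmax σ ∧ lmic₁ (e σ) = lmin σ ∧ ∀ i, IsLmax (e σ) i ↔ IsLmax σ⁻¹ i := by
  induction n with
  | zero =>
    refine ⟨Equiv.refl _, fun σ => ⟨?_, ?_, fun i => i.elim0⟩⟩
    · have : IsEmpty (Quotient (Perm.SameCycle.setoid σ)) := ⟨fun q => q.out.elim0⟩
      simp [cyc, lmax]
    · simp [lmic₁, lmin]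
  | succ n ih =>
    obtain ⟨e, he⟩ := ih
    -- `appendLetter τ c` is sent to `insertInCycle (e τ) c`.
    refine ⟨(appendLetterEquiv n).symm.trans
      ((Equiv.prodCongr e (Equiv.refl _)).trans (insertInCycleEquiv n)), fun σ => ?_⟩
    obtain ⟨⟨τ, c⟩, rfl⟩ := (appendLetterEquiv n).surjective σ
    obtain ⟨h1, h2, h3⟩ := he τ
    simp only [Equiv.trans_apply, Equiv.symm_apply_apply, Equiv.prodCongr_apply, Prod.map,
      Equiv.refl_apply]
    change cyc (insertInCycle (e τ) c) = lmax (appendLetter τ c) ∧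
      lmic₁ (insertInCycle (e τ) c) = lmin (appendLetter τ c) ∧
      ∀ i, IsLmax (insertInCycle (e τ) c) i ↔ IsLmax (appendLetter τ c)⁻¹ i
    rw [cyc_insertInCycle, lmax_appendLetter, lmic₁_insertInCycle, lmin_appendLetter, h1, h2]
    exact ⟨rfl, rfl, isLmax_insertInCycle_iff_appendLetter_inv h3 c⟩

theorem exists_equiv_cyc_lmic₁_lmax (n : ℕ) : ∃ e : Perm (Fin n) ≃ Perm (Fin n), ∀ σ,
    cyc (e σ) = lmax σ ∧ lmic₁ (e σ) = lmin σ ∧ lmax (e σ) = rmin σ := by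
  obtain ⟨e, he⟩ := exists_equiv_cyc_lmic₁_isLmax n
  refine ⟨e, fun σ => ⟨(he σ).1, (he σ).2.1, ?_⟩⟩
  rw [← lmax_inv]
  exact lmax_eq_of_isLmax_iff (he σ).2.2

/-! ### The generating function of `(lmax, lmin)` -/

theorem genFun_lmax_lmin_succ (n : ℕ) {R : Type*} [CommRing R] (x y : R) :
    genFun (n := n + 1) lmax lmin x y = genFun (n := n) lmax lmin x y *
      ∑ c : Fin (n + 1), x ^ (if c = Fin.last n then 1 else 0) * y ^ (if c = 0 then 1 else 0) := by
  rw [genFun, genFun, ← (appendLetterEquiv n).sum_comp, Fintype.sum_prod_type, Finset.sum_mul_sum]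
  refine Finset.sum_congr rfl fun σ _ => Finset.sum_congr rfl fun c _ => ?_
  change x ^ lmax (appendLetter σ c) * y ^ lmin (appendLetter σ c) = _
  rw [lmax_appendLetter, lmin_appendLetter, pow_add, pow_add]
  ring

theorem genFun_lmax_lmin (n : ℕ) (hn : 1 ≤ n) {R : Type*} [CommRing R] (x y : R) :
    genFun (n := n) lmax lmin x y = x * y * ∏ r ∈ Finset.Icc 2 n, (x + y + ((r : R) - 2)) := by
  induction n, hn using Nat.le_induction with
  | base => simp [genFun, lmax, lmin]
  | succ n hn ih =>
    -- With at least two letters, `0` and the largest are distinct: they contribute `y` and `x`, and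
    -- the `m` letters between contribute `1` each. The factor is `x + y + m`, with `r = m + 2`.
    obtain ⟨m, rfl⟩ := Nat.exists_eq_add_of_le' hn
    rw [genFun_lmax_lmin_succ, ih, Finset.prod_Icc_succ_top (show 2 ≤ m + 1 + 1 by omega), Fin.sum_univ_succ,
      Fin.sum_univ_castSucc]
    have h (i : Fin m) : i.castSucc.succ ≠ Fin.last (m + 1) := by
      rw [← Fin.castSucc_succ]
      exact (Fin.castSucc_lt_last _).ne
    simp [h, Fin.succ_ne_zero]
    ring

/-! ### The two families -/

theorem corresponds_lmax_lmin_swap : Corresponds (n := n) (lmax, lmin) (lmin, lmax) :=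
  ⟨Equiv.mulLeft Fin.revPerm, fun σ => ⟨lmax_rev_mul σ, lmin_rev_mul σ⟩⟩

theorem corresponds_rmin_lmin : Corresponds (n := n) (rmin, lmin) (lmax, lmin) :=
  ⟨Equiv.inv _, fun σ => ⟨by simp [← lmax_inv], lmin_inv σ⟩⟩

theorem corresponds_lmax_lmin_of_mem_pairs₁ {s : (Perm (Fin n) → ℕ) × (Perm (Fin n) → ℕ)}
    (hs : s ∈ pairs₁ n) : Corresponds s (lmax, lmin) := by
  obtain ⟨e, he⟩ := exists_equiv_cyc_lmic₁_lmax n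
  simp only [pairs₁, List.mem_cons, List.not_mem_nil, or_false] at hs
  rcases hs with rfl | rfl | rfl | rfl | rfl | rfl
  · exact ⟨Equiv.mulRight Fin.revPerm, fun σ => ⟨rmax_mul_rev σ, rmin_mul_rev σ⟩⟩
  · refine Corresponds.trans (Corresponds.symm ?_) corresponds_rmin_lmin
    exact ⟨Equiv.mulLeft Fin.revPerm, fun σ => ⟨rmin_rev_mul σ, lmin_rev_mul σ⟩⟩
  · exact corresponds_rmin_lmin
  · exact Corresponds.refl _
  · exact ⟨e, fun σ => ⟨(he σ).1, (he σ).2.1⟩⟩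
  -- The bijection `e` turns `(lmic₁, lmax)` into `(lmin, rmin)`; inversion and complement do the
  -- rest.
  · refine Corresponds.trans (t := (lmin, rmin)) ⟨e, fun σ => (he σ).2⟩ ?_
    exact corresponds_rmin_lmin.swap.trans corresponds_lmax_lmin_swap.symm

theorem lmax_conj_rev (σ : Perm (Fin n)) : lmax (Fin.revPerm * σ * Fin.revPerm) = rmin σ := by
  rw [mul_assoc, lmax_rev_mul, lmin_mul_rev]

theorem rmin_conj_rev (σ : Perm (Fin n)) : rmin (Fin.revPerm * σ * Fin.revPerm) = lmax σ := by
  rw [mul_assoc, rmin_rev_mul, rmax_mul_rev]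

/-- Conjugation by the reversal rotates the diagram by a half turn, exchanging the upper left and
lower right quadrants. -/
theorem corresponds_lmax_rmin_swap : Corresponds (n := n) (lmax, rmin) (rmin, lmax) :=
  ⟨(Equiv.mulLeft Fin.revPerm).trans (Equiv.mulRight Fin.revPerm),
    fun σ => ⟨lmax_conj_rev σ, rmin_conj_rev σ⟩⟩

theorem corresponds_lmax_rmin_of_mem_pairs₂ {s : (Perm (Fin n) → ℕ) × (Perm (Fin n) → ℕ)}
    (hs : s ∈ pairs₂ n) : Corresponds s (lmax, rmin) := by
  obtain ⟨e, he⟩ := exists_equiv_cyc_lmic₁_lmax n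
  have hcyc : Corresponds (n := n) (cyc, lmax) (lmax, rmin) :=
    ⟨e, fun σ => ⟨(he σ).1, (he σ).2.2⟩⟩
  simp only [pairs₂, List.mem_cons, List.not_mem_nil, or_false] at hs
  rcases hs with rfl | rfl | rfl | rfl
  · exact ⟨Equiv.mulRight Fin.revPerm, fun σ => ⟨rmax_mul_rev σ, lmin_mul_rev σ⟩⟩
  · exact corresponds_lmax_rmin_swap.symm
  · exact hcyc
  -- The half turn is a conjugation, so it preserves `cyc` while exchanging `rmin` and `lmax`.
  · refine Corresponds.trans (t := (cyc, lmax)) ?_ hcyc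
    exact ⟨(Equiv.mulLeft Fin.revPerm).trans (Equiv.mulRight Fin.revPerm),
      fun σ => ⟨cyc_conj_rev σ, rmin_conj_rev σ⟩⟩

end PermStat

theorem corollary5p3 (n : ℕ) (hn : 1 ≤ n) :
    ((∀ s ∈ PermStat.pairs₁ n, PermStat.SymmetricPair s) ∧
      (∀ s ∈ PermStat.pairs₁ n, ∀ t ∈ PermStat.pairs₁ n, PermStat.JointlyEquidistributed s t) ∧
      (∀ s ∈ PermStat.pairs₁ n, ∀ (R : Type*) [CommRing R] (x y : R),
        PermStat.genFun s.1 s.2 x y = PermStat.F n 1 x y ∧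
        PermStat.genFun s.1 s.2 x y = x * y * ∏ r ∈ Finset.Icc 2 n, (x + y + ((r : R) - 2)))) ∧
    ((∀ s ∈ PermStat.pairs₂ n, PermStat.SymmetricPair s) ∧
      (∀ s ∈ PermStat.pairs₂ n, ∀ t ∈ PermStat.pairs₂ n,
        PermStat.JointlyEquidistributed s t)) := by
  have h₁ {s} (hs : s ∈ PermStat.pairs₁ n) := PermStat.corresponds_lmax_lmin_of_mem_pairs₁ hs
  have h₂ {s} (hs : s ∈ PermStat.pairs₂ n) := PermStat.corresponds_lmax_rmin_of_mem_pairs₂ hs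
  refine ⟨⟨fun s hs => ?_, fun s hs t ht => ?_, fun s hs R _ x y => ⟨?_, ?_⟩⟩,
    fun s hs => ?_, fun s hs t ht => ?_⟩
  -- Symmetry of the model pair `(lmax, lmin)` is transported to `s` along the correspondence and
  -- its swap.
  · exact (((h₁ hs).trans PermStat.corresponds_lmax_lmin_swap).trans
      (h₁ hs).swap.symm).jointlyEquidistributed
  · exact ((h₁ hs).trans (h₁ ht).symm).jointlyEquidistributed
  · have hc : (PermStat.cyc, PermStat.lmic₁) ∈ PermStat.pairs₁ n := by simp [PermStat.pairs₁]
    rw [((h₁ hs).trans (h₁ hc).symm).genFun_eq]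
    simp [PermStat.F, PermStat.genFun]
  · rw [(h₁ hs).genFun_eq]
    exact PermStat.genFun_lmax_lmin n hn x y
  · exact (((h₂ hs).trans PermStat.corresponds_lmax_rmin_swap).trans
      (h₂ hs).swap.symm).jointlyEquidistributed
  · exact ((h₂ hs).trans (h₂ ht).symm).jointlyEquidistributed
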